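/- Let $k\ge 4$ be even and put $a=k/2$; let $m\ge a$, let $\mathcal R=\{R_1,\dots,R_m\}$ and $\mathcal C=\{C_1,\dots,C_m\}$ be disjoint $m$-sets, and let $\mathcal P=\mathcal R\times\mathcal C$. Let $\Delta=C_k$ be the cycle of length $k$ in the complete bipartite graph on $\mathcal R\cup\mathcal C$ with edges $\{R_i,C_i\}$ ($1\le i\le a$), $\{R_{i+1},C_i\}$ ($1\le i\le a-1$) and $\{R_1,C_a\}$, and let $B=\{(R,C)\in\mathcal P : \{R,C\}\text{ is an edge of }\Delta\}$. Let $K=\mathrm{Sym}(\mathcal R)\times\mathrm{Sym}(\mathcal C)$ act on $\mathcal P$ in the product action, and let $G=\langle K,\tau\rangle\cong S_m\wr S_2$, where $\tau:(R_i,C_j)\mapsto(R_j,C_i)$. Let $\mathcal D(\Delta)$ and $\widehat{\mathcal D}(\Delta)$ be the incidence structures with point set $\mathcal P$ and block sets $\{B^g: g\in K\}$ and $\{B^g: g\in G\}$ respectively. For positive integers $t,v,\kappa,\lambda$, a $t$-$(v,\kappa,\lambda)$ design is an incidence structure with $v$ points, all blocks of size $\kappa$, and every $t$-element set of points contained in exactly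 $\lambda$ blocks; a $t$-design is a $t$-$(v,\kappa,\lambda)$ design for some positive $v,\kappa,\lambda$. A group of automorphisms is flag-transitive if it is transitive on the incident point-block pairs. Then $\mathcal D(\Delta)=\widehat{\mathcal D}(\Delta)=:\mathcal D$ is a $1$-$(m^2,k,\lambda_1)$ design for some $\lambda_1$, and both $K$ and $G$ are flag-transitive on $\mathcal D$. If $m\neq 2$ (that is, apart from the trivial case $(m,k)=(2,4)$, in which the only block is $\mathcal P$), then $\mathcal D$ is not a $3$-design. Moreover $\mathcal D$ is a $2$-design if and only if $m=k-2$, in which case $\mathcal D$ is a $2$-$((k-2)^2,k,\lambda)$ design with $$\lambda=\frac{(k-3)!\,(k-4)!}{\big((k/2-2)!\big)^2}.$$ -/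

import Mathlib

open scoped Nat

namespace GridDesign

/-- A point-block incidence structure on the point set `P`: blocks are subsets of `P`,
incidence is membership. -/
@[ext]
structure IncidenceStructure (P : Type*) where
  /-- The set of blocks. -/
  blocks : Set (Set P)

/-- `D` is a `t`-`(v, k, lam)` design, for positive integers `t, v, k, lam`: there are `v` points,
every block has size `k`, and every `t`-element set of points lies in exactly `lam` blocks. -/
structure IncidenceStructure.IsDesign {P : Type*} (D : IncidenceStructure P)
    (t v k lam : ℕ) : Prop where
  t_pos : 0 < t
  v_pos : 0 < v
  k_pos : 0 < k
  lam_pos : 0 < lam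
  card_points : Nat.card P = v
  card_block : ∀ b ∈ D.blocks, b.ncard = k
  card_blocks_containing : ∀ T : Finset P, T.card = t →
    {b ∈ D.blocks | (T : Set P) ⊆ b}.ncard = lam

/-- `D` is a `t`-design: a `t`-`(v, k, lam)` design for some `v, k, lam`. -/
def IncidenceStructure.IsTDesign {P : Type*} (D : IncidenceStructure P) (t : ℕ) : Prop :=
  ∃ v k lam : ℕ, D.IsDesign t v k lam

/-- The permutation group `H` on the points acts flag-transitively on `D`: it consists of
automorphisms of `D`, and it is transitive on the incident point-block pairs. -/
def IncidenceStructure.IsFlagTransitive {P : Type*} (D : IncidenceStructure P)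
    (H : Subgroup (Equiv.Perm P)) : Prop :=
  (∀ g ∈ H, ∀ b : Set P, g '' b ∈ D.blocks ↔ b ∈ D.blocks) ∧
    ∀ b ∈ D.blocks, ∀ p ∈ b, ∀ b' ∈ D.blocks, ∀ p' ∈ b', ∃ g ∈ H, g p = p' ∧ g '' b = b'

/-- The points of the square grid: pairs (row, column). -/
abbrev Grid (m : ℕ) : Type := Fin m × Fin m

/-- `Sym(R) × Sym(C)` in its product action on the points of the grid. -/
def groupK (m : ℕ) : Subgroup (Equiv.Perm (Grid m)) where
  carrier := {g | ∃ σ ρ : Equiv.Perm (Fin m), g = Equiv.prodCongr σ ρ}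
  one_mem' := ⟨1, 1, rfl⟩
  mul_mem' := by
    rintro _ _ ⟨σ, ρ, rfl⟩ ⟨σ', ρ', rfl⟩
    exact ⟨σ * σ', ρ * ρ', rfl⟩
  inv_mem' := by
    rintro _ ⟨σ, ρ, rfl⟩
    exact ⟨σ⁻¹, ρ⁻¹, rfl⟩

/-- The transposition `(R_i, C_j) ↦ (R_j, C_i)` of the grid. -/
def tau (m : ℕ) : Equiv.Perm (Grid m) := Equiv.prodComm (Fin m) (Fin m)

/-- The group generated by `Sym(R) × Sym(C)` and the transposition, i.e. the wreath product
of `Sym(m)` with `Sym(2)` in its product action. -/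
def groupG (m : ℕ) : Subgroup (Equiv.Perm (Grid m)) :=
  Subgroup.closure ((groupK m : Set (Equiv.Perm (Grid m))) ∪ {tau m})

/-- The set of points `(R, C)` such that `{R, C}` is an edge of the graph `Δ`, a subgraph of the
complete bipartite graph whose vertices are the rows `inl i` and the columns `inr j`. -/
def blockOf {m : ℕ} (Δ : SimpleGraph (Fin m ⊕ Fin m)) : Set (Grid m) :=
  {p | Δ.Adj (Sum.inl p.1) (Sum.inr p.2)}

/-- The block of the image of `Δ` under an element of `Sym(R) × Sym(C)` acting on vertices is the
image of the block of `Δ` in the product action. -/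
theorem blockOf_map_sumCongr {m : ℕ} (Δ : SimpleGraph (Fin m ⊕ Fin m))
    (σ ρ : Equiv.Perm (Fin m)) :
    blockOf (Δ.map (Equiv.sumCongr σ ρ)) = Equiv.prodCongr σ ρ '' blockOf Δ := by
  ext ⟨i, j⟩
  simp only [blockOf, Set.mem_ofPred_eq, Set.mem_image]
  constructor
  · rintro ⟨-, u | u, v | v, h, hu, hv⟩ <;> simp at hu hv
    exact ⟨(u, v), h, by simp [hu, hv]⟩
  · rintro ⟨⟨u, v⟩, h, huv⟩
    simp only [Equiv.prodCongr_apply, Prod.map_apply, Prod.mk.injEq] at huv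
    exact ⟨by simp, _, _, h, by simp [huv.1], by simp [huv.2]⟩

/-- The block of the image of `Δ` under the vertex map that swaps `R_i` and `C_i` for all `i`
is the image of the block of `Δ` under the transposition of the grid. -/
theorem blockOf_map_sumComm {m : ℕ} (Δ : SimpleGraph (Fin m ⊕ Fin m)) :
    blockOf (Δ.map (Equiv.sumComm (Fin m) (Fin m))) = tau m '' blockOf Δ := by
  ext ⟨i, j⟩
  simp only [blockOf, Set.mem_ofPred_eq, Set.mem_image]
  constructor
  · rintro ⟨-, u | u, v | v, h, hu, hv⟩ <;> simp at hu hv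
    exact ⟨(v, u), h.symm, by simp [tau, hu, hv]⟩
  · rintro ⟨⟨u, v⟩, h, huv⟩
    simp only [tau, Equiv.prodComm_apply, Prod.swap_prod_mk, Prod.mk.injEq] at huv
    exact ⟨by simp, _, _, h.symm, by simp [huv.1], by simp [huv.2]⟩

/-- The incidence structure on the grid whose blocks are the images under `H` of the block of `Δ`,
i.e. (by the two facts above) the blocks of the images of `Δ` under `H`. -/
def designOf {m : ℕ} (H : Subgroup (Equiv.Perm (Grid m))) (Δ : SimpleGraph (Fin m ⊕ Fin m)) :
    IncidenceStructure (Grid m) where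
  blocks := {b | ∃ g ∈ H, b = g '' blockOf Δ}

/-- The incidence structure `D(Δ)`. -/
def designD {m : ℕ} (Δ : SimpleGraph (Fin m ⊕ Fin m)) : IncidenceStructure (Grid m) :=
  designOf (groupK m) Δ

/-- The incidence structure `D̂(Δ)`. -/
def designDhat {m : ℕ} (Δ : SimpleGraph (Fin m ⊕ Fin m)) : IncidenceStructure (Grid m) :=
  designOf (groupG m) Δ

/-- The cycle of length `k = 2a ≥ 4` in the complete bipartite graph on `m` rows and `m ≥ a`
columns. Numbering rows and columns from `0`, its edges are `{R_i, C_i}` for `i < a`,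
`{R_{i+1}, C_i}` for `i + 1 < a`, and `{R_0, C_{a-1}}`. -/
def evenCycle (m k : ℕ) : SimpleGraph (Fin m ⊕ Fin m) :=
  SimpleGraph.fromEdgeSet {e | ∃ i j : Fin m, e = s(Sum.inl i, Sum.inr j) ∧
    ((i.val = j.val ∧ j.val < k / 2) ∨
      (i.val = j.val + 1 ∧ j.val + 1 < k / 2) ∨
      (i.val = 0 ∧ j.val + 1 = k / 2))}

end GridDesign

open scoped Nat

namespace GridDesign

open Equiv

/-! ### The cycle block and its stabilizer. -/

section

/-! Write `k = 2a`. The block is the set of cells `(j, j)` and `(j + 1, j)` with `j` modulo `a`. The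
dihedral symmetries of the cycle that preserve the two sides lie in `K`, as do their composites with
row-column swaps realised by independent relabellings, so the stabilizer of the block in `K` is
transitive on its `2a` cells. This yields flag-transitivity. Transposing the grid has the same
effect on the block as an element of `K`, so `τ` creates no new blocks.

An element of `K` fixing the block and one of its cells fixes every row and column of the cycle,
hence the stabilizer has order `2a ((m - a)!)^2` (`card_stabilizer`). Counting the elements of `K`
that carry a given pair into the block then gives the number of blocks through that pair
(`ncard_blocks_containing_pair`). The block has `2a` ordered pairs in a common row, as many in a
common column, and `2a (2a - 3)` others. So the number of blocks through a pair, times `((m -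
a)!)^2`, is `(m - 1)! (m - 2)!` for collinear pairs and `(2a - 3) ((m - 2)!)^2` for the rest; these
agree exactly when `m - 1 = 2a - 3`. Three cells of one row lie in no block, which excludes
3-designs. -/

/-- The cyclic shift of the first `a` elements of `Fin m`, fixing the other elements. -/
def shift {m a : ℕ} (h : a ≤ m) : Perm (Fin m) where
  toFun i := if h1 : i.val + 1 < a then ⟨i.val + 1, by omega⟩
    else if i.val + 1 = a then ⟨0, by have := i.isLt; omega⟩ else i
  invFun i := if i.val < a then
    (if i.val = 0 then ⟨a - 1, by have := i.isLt; omega⟩ 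
      else ⟨i.val - 1, by have := i.isLt; omega⟩) else i
  left_inv i := by
    apply Fin.ext
    dsimp only
    split_ifs <;> dsimp only at * <;> omega
  right_inv i := by
    apply Fin.ext
    by_cases h1 : i.val < a
    · by_cases h2 : i.val = 0
      · have h3 : a - 1 + 1 = a := by omega
        simp [h2, h3, show 0 < a by omega]
      · have h3 : i.val - 1 + 1 = i.val := by omega
        simp [h1, h2, h3]
    · simp [h1, show ¬ i.val + 1 < a by omega, show ¬ i.val + 1 = a by omega]

/-- The reflection of the first `a` elements of `Fin m`, fixing the other elements. -/
def reflect {m a : ℕ} (h : a ≤ m) : Perm (Fin m) where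
  toFun i := if i.val < a then ⟨a - 1 - i.val, by have := i.isLt; omega⟩ else i
  invFun i := if i.val < a then ⟨a - 1 - i.val, by have := i.isLt; omega⟩ else i
  left_inv i := by
    apply Fin.ext
    dsimp only
    split_ifs <;> dsimp only at * <;> omega
  right_inv i := by
    apply Fin.ext
    dsimp only
    split_ifs <;> dsimp only at * <;> omega

theorem shift_val {m a : ℕ} (h : a ≤ m) (i : Fin m) :
    (shift h i).val = if i.val + 1 < a then i.val + 1 else if i.val + 1 = a then 0 else i.val := by
  simp only [shift, Equiv.coe_fn_mk]; split_ifs <;> rfl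

theorem reflect_val {m a : ℕ} (h : a ≤ m) (i : Fin m) :
    (reflect h i).val = if i.val < a then a - 1 - i.val else i.val := by
  simp only [reflect, Equiv.coe_fn_mk]; split_ifs <;> rfl

theorem shift_val_lt_iff {m a : ℕ} (h : a ≤ m) (i : Fin m) :
    (shift h i).val < a ↔ i.val < a := by
  rw [shift_val]; split_ifs <;> omega

theorem reflect_val_lt_iff {m a : ℕ} (h : a ≤ m) (i : Fin m) :
    (reflect h i).val < a ↔ i.val < a := by
  rw [reflect_val]; split_ifs <;> omega

/-- The dihedral relation: modulo `a` the maps are `x ↦ x + 1` and `x ↦ -1 - x`. -/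
theorem shift_reflect_shift {m a : ℕ} (h : a ≤ m) (i : Fin m) :
    shift h (reflect h (shift h i)) = reflect h i := by
  ext; simp only [shift_val, reflect_val]; split_ifs <;> omega

theorem shift_pow_val {m a : ℕ} (h : a ≤ m) (i : Fin m) (hi : i.val = 0) :
    ∀ n < a, ((shift h ^ n) i).val = n
  | 0, _ => by simpa using hi
  | n + 1, hn => by
    rw [pow_succ', Perm.mul_apply, shift_val, shift_pow_val h i hi n (by omega)]
    simp [hn]

/-- The closing edge `{R_0, C_{a-1}}` is absorbed by the wrap-around of `shift`. -/
theorem blockOf_evenCycle {m a : ℕ} (h : a ≤ m) :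
    blockOf (evenCycle m (2 * a)) =
      {p : Grid m | p.2.val < a ∧ (p.1 = p.2 ∨ p.1 = shift h p.2)} := by
  ext ⟨i, j⟩
  simp only [blockOf, evenCycle, Set.mem_ofPred_eq, SimpleGraph.fromEdgeSet_adj, Fin.ext_iff,
    shift_val, Nat.mul_div_cancel_left a (by omega : 0 < 2)]
  constructor
  · rintro ⟨⟨i', j', hij, hc⟩, -⟩
    simp only [Sym2.eq_iff, Sum.inl.injEq, Sum.inr.injEq, reduceCtorEq, and_self, or_false] at hij
    obtain ⟨rfl, rfl⟩ := hij
    split_ifs <;> omega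
  · intro hc
    refine ⟨⟨i, j, rfl, ?_⟩, by simp⟩
    split_ifs at hc <;> omega

variable {m a : ℕ} (h : a ≤ m)

/-- The cells `(j, j)` and `(j + 1, j)` with `j` modulo `a`. -/
def cycleBlock : Finset (Grid m) :=
  Finset.univ.filter fun p => p.2.val < a ∧ (p.1 = p.2 ∨ p.1 = shift h p.2)

theorem mem_cycleBlock {p : Grid m} :
    p ∈ cycleBlock h ↔ p.2.val < a ∧ (p.1 = p.2 ∨ p.1 = shift h p.2) := by
  simp [cycleBlock]

theorem coe_cycleBlock :
    (cycleBlock h : Set (Grid m)) = blockOf (evenCycle m (2 * a)) := by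
  rw [blockOf_evenCycle h]; ext p; simp [cycleBlock]

theorem shift_ne (ha : 2 ≤ a) {i : Fin m} (hi : i.val < a) : shift h i ≠ i := by
  rw [Ne, Fin.ext_iff, shift_val]; split_ifs <;> omega

theorem card_filter_val_lt {m a : ℕ} (h : a ≤ m) :
    (Finset.univ.filter fun i : Fin m => i.val < a).card = a := by
  rw [Fin.card_filter_val_lt]; exact min_eq_right h

theorem card_cycleBlock (ha : 2 ≤ a) : (cycleBlock h).card = 2 * a := by
  have hB : cycleBlock h =
      (Finset.univ.filter fun i : Fin m => i.val < a).image (fun j => (j, j)) ∪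
      (Finset.univ.filter fun i : Fin m => i.val < a).image (fun j => (shift h j, j)) := by
    ext ⟨i, j⟩
    simp only [mem_cycleBlock, Finset.mem_union, Finset.mem_image, Finset.mem_filter,
      Finset.mem_univ, true_and, Prod.mk.injEq]
    constructor
    · rintro ⟨hj, rfl | rfl⟩
      · exact Or.inl ⟨_, hj, rfl, rfl⟩
      · exact Or.inr ⟨_, hj, rfl, rfl⟩
    · rintro (⟨x, hx, rfl, rfl⟩ | ⟨x, hx, rfl, rfl⟩)
      · exact ⟨hx, Or.inl rfl⟩
      · exact ⟨hx, Or.inr rfl⟩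
  rw [hB, Finset.card_union_of_disjoint, Finset.card_image_of_injective,
    Finset.card_image_of_injective, card_filter_val_lt h, two_mul]
  · intro x y hxy; exact (Prod.mk.inj hxy).2
  · intro x y hxy; exact (Prod.mk.inj hxy).2
  · rw [Finset.disjoint_left]
    simp only [Finset.mem_image, Finset.mem_filter, Finset.mem_univ, true_and, not_exists, not_and]
    rintro _ ⟨x, hx, rfl⟩ y hy hxy
    obtain ⟨h1, h2⟩ := Prod.mk.inj hxy
    exact shift_ne h ha hy (h1.trans h2.symm)

theorem prodCongr_mul_image (σ σ' ρ ρ' : Perm (Fin m)) (s : Set (Grid m)) :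
    Equiv.prodCongr (σ * σ') (ρ * ρ') '' s =
      Equiv.prodCongr σ ρ '' (Equiv.prodCongr σ' ρ' '' s) := by
  rw [← Set.image_comp]; rfl

theorem image_finset_eq_of_mapsTo {P : Type*} (g : Perm P) (s : Finset P)
    (hs : ∀ p ∈ s, g p ∈ s) : g '' (s : Set P) = s := by
  classical
  rw [← Finset.coe_image, Finset.coe_inj]
  exact Finset.eq_of_subset_of_card_le (Finset.image_subset_iff.2 hs)
    (Finset.card_image_of_injective s g.injective).ge

theorem shift_image_cycleBlock :
    Equiv.prodCongr (shift h) (shift h) '' (cycleBlock h : Set (Grid m)) = cycleBlock h := by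
  apply image_finset_eq_of_mapsTo
  rintro ⟨i, j⟩ hp
  simp only [mem_cycleBlock, prodCongr_apply, Prod.map, shift_val_lt_iff] at hp ⊢
  simpa using hp

/-- This symmetry exchanges the two kinds of cells, which `shift` alone cannot do. -/
theorem reflect_image_cycleBlock :
    Equiv.prodCongr (shift h * reflect h) (reflect h) '' (cycleBlock h : Set (Grid m)) =
      cycleBlock h := by
  apply image_finset_eq_of_mapsTo
  rintro ⟨i, j⟩ hp
  simp only [mem_cycleBlock, prodCongr_apply, Prod.map, reflect_val_lt_iff, Perm.mul_apply]
    at hp ⊢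
  obtain ⟨hj, rfl | rfl⟩ := hp
  · exact ⟨hj, Or.inr rfl⟩
  · exact ⟨hj, Or.inl (shift_reflect_shift h j)⟩

/-- Transposing and then shifting the rows sends `(j, j)` to `(j + 1, j)` and `(j + 1, j)` to `(j +
1, j + 1)`. -/
theorem tau_image_cycleBlock :
    tau m '' (cycleBlock h : Set (Grid m)) =
      ((Equiv.prodCongr (shift h) 1)⁻¹ : Perm (Grid m)) ''
        (cycleBlock h : Set (Grid m)) := by
  have : (Equiv.prodCongr (shift h) 1 * tau m : Perm (Grid m)) '' (cycleBlock h : Set (Grid m)) =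
      cycleBlock h := by
    apply image_finset_eq_of_mapsTo
    rintro ⟨i, j⟩ hp
    simp only [mem_cycleBlock, prodCongr_apply, Prod.map, Perm.mul_apply, tau, prodComm_apply,
      Prod.swap, Perm.one_apply] at hp ⊢
    obtain ⟨hj, rfl | rfl⟩ := hp
    · exact ⟨hj, Or.inr rfl⟩
    · exact ⟨(shift_val_lt_iff h j).2 hj, Or.inl rfl⟩
  conv_rhs => rw [← this]
  rw [← Set.image_comp, ← Perm.coe_mul, inv_mul_cancel_left]

/-- The stabilizer of the block in `Sym(R) × Sym(C)` is transitive on the block. -/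
theorem exists_stabilizer_apply_eq {o : Fin m} (ho : o.val = 0) {p : Grid m}
    (hp : p ∈ cycleBlock h) :
    ∃ σ ρ : Perm (Fin m), Equiv.prodCongr σ ρ '' (cycleBlock h : Set (Grid m)) = cycleBlock h ∧
      Equiv.prodCongr σ ρ (o, o) = p := by
  have hpow : ∀ n : ℕ, Equiv.prodCongr (shift h ^ n) (shift h ^ n) ''
      (cycleBlock h : Set (Grid m)) = cycleBlock h := by
    intro n
    induction n with
    | zero => exact Set.image_id _
    | succ n ih =>
      rw [pow_succ, prodCongr_mul_image, shift_image_cycleBlock, ih]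
  have hex : ∀ i j : Fin m, i.val < a → j.val < a → ∃ n : ℕ, (shift h ^ n) i = j := by
    have h0 : ∀ j : Fin m, j.val < a → (shift h ^ j.val) o = j :=
      fun j hj => Fin.ext (shift_pow_val h o ho _ hj)
    intro i j hi hj
    -- Finite order turns the integer power `j - i` into a natural one.
    have hfin : (shift h ^ j.val * (shift h ^ i.val)⁻¹ : Perm (Fin m)) ∈
      Submonoid.powers (shift h) := by
      rw [mem_powers_iff_mem_zpowers]
      exact mul_mem (pow_mem (Subgroup.mem_zpowers _) _)
        (inv_mem (pow_mem (Subgroup.mem_zpowers _) _))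
    obtain ⟨n, hn⟩ := hfin
    refine ⟨n, ?_⟩
    change shift h ^ n = _ at hn
    rw [hn, Perm.mul_apply, Perm.inv_eq_iff_eq.2 (h0 i hi).symm, h0 j hj]
  obtain ⟨i, j⟩ := p
  obtain ⟨hj, hij⟩ := (mem_cycleBlock h).1 hp
  dsimp only at hj hij
  have ha : 0 < a := by omega
  obtain rfl | rfl := hij
  · obtain ⟨n, hn⟩ := hex o i (by omega) hj
    exact ⟨_, _, hpow n, by simp [hn]⟩
  -- The reflection first moves the corner to an off-diagonal cell, in column `reflect h o`; a power
  -- of the shift then brings that column to `j`.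
  · obtain ⟨n, hn⟩ := hex (reflect h o) j ((reflect_val_lt_iff h o).2 (by omega)) hj
    refine ⟨shift h ^ n * (shift h * reflect h), shift h ^ n * reflect h, ?_, ?_⟩
    · rw [prodCongr_mul_image, reflect_image_cycleBlock, hpow n]
    · have hc : shift h ^ n * shift h = shift h * shift h ^ n :=
        ((Commute.refl (shift h)).pow_left n).eq
      simp only [prodCongr_apply, Prod.map, ← mul_assoc, hc, Perm.mul_apply, hn]

/-- Walk along the cycle from the corner: each vertex has two neighbours, and once it and one
neighbour are fixed, injectivity forces the other to be fixed. -/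
theorem stabilizer_fixing_corner_iff (ha : 2 ≤ a) {o : Fin m} (ho : o.val = 0)
    (σ ρ : Perm (Fin m)) :
    (Equiv.prodCongr σ ρ '' (cycleBlock h : Set (Grid m)) = cycleBlock h ∧
      Equiv.prodCongr σ ρ (o, o) = (o, o)) ↔
    (∀ i : Fin m, i.val < a → σ i = i) ∧ (∀ i : Fin m, i.val < a → ρ i = i) := by
  constructor
  · rintro ⟨hB, hp⟩
    have hσo : σ o = o := congrArg Prod.fst hp
    have hρo : ρ o = o := congrArg Prod.snd hp
    have key : ∀ n (hn : n < a), σ ⟨n, by omega⟩ = ⟨n, by omega⟩ ∧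
        ρ ⟨n, by omega⟩ = ⟨n, by omega⟩ := by
      have hmap : ∀ i j : Fin m, (i, j) ∈ cycleBlock h → (σ i, ρ j) ∈ cycleBlock h := by
        intro i j hij
        rw [← Finset.mem_coe, ← hB]
        exact ⟨_, hij, rfl⟩
      intro n
      induction n with
      | zero =>
        intro hn
        have : (⟨0, by omega⟩ : Fin m) = o := Fin.ext ho.symm
        rw [this]; exact ⟨hσo, hρo⟩
      | succ n ih =>
        intro hn
        obtain ⟨h1, h2⟩ := ih (by omega)
        have hs : shift h ⟨n, by omega⟩ = ⟨n + 1, by omega⟩ := by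
          ext; rw [shift_val]; simp [hn]
        have h3 := hmap ⟨n + 1, by omega⟩ ⟨n, by omega⟩
          ((mem_cycleBlock h).2 ⟨by dsimp only; omega, Or.inr hs.symm⟩)
        rw [h2, mem_cycleBlock] at h3
        have h4 : σ ⟨n + 1, by omega⟩ = ⟨n + 1, by omega⟩ := by
          rcases h3.2 with h3 | h3
          · have := σ.injective (h3.trans h1.symm)
            simp at this
          · exact h3.trans hs
        refine ⟨h4, ?_⟩
        have h5 := hmap ⟨n + 1, by omega⟩ ⟨n + 1, by omega⟩
          ((mem_cycleBlock h).2 ⟨hn, Or.inl rfl⟩)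
        rw [h4, mem_cycleBlock] at h5
        rcases h5.2 with h5 | h5
        · exact h5.symm
        · have h6 := (shift h).injective (hs.trans h5)
          have := ρ.injective (h2.trans h6)
          simp at this
    exact ⟨fun i hi => (key i.val hi).1, fun i hi => (key i.val hi).2⟩
  · rintro ⟨h1, h2⟩
    refine ⟨?_, Prod.ext (h1 o (by omega)) (h2 o (by omega))⟩
    apply image_finset_eq_of_mapsTo
    rintro ⟨i, j⟩ hp
    have hj := (mem_cycleBlock h).1 hp
    dsimp only at hj
    have hi : i.val < a := by
      rcases hj.2 with rfl | rfl
      · exact hj.1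
      · exact (shift_val_lt_iff h j).2 hj.1
    rw [prodCongr_apply, Prod.map, h1 i hi, h2 j hj.1]
    exact hp

end

/-! ### Counting permutations and orbits. -/

section

section PermCounts

variable {α : Type*} [Fintype α] [DecidableEq α]

theorem card_perm_fixing (p : α → Prop) [DecidablePred p] :
    (Finset.univ.filter fun σ : Perm α => ∀ i, p i → σ i = i).card =
      (Fintype.card α - (Finset.univ.filter p).card)! := by
  rw [← Fintype.card_subtype, ← Fintype.card_subtype, ← Fintype.card_subtype_compl p,
    ← Fintype.card_perm]
  refine Fintype.card_congr ((Equiv.subtypeEquivRight ?_).trans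
    (Perm.subtypeEquivSubtypePerm fun i => ¬ p i).symm)
  intro σ
  simp

theorem card_perm_eq_on (p : α → Prop) [DecidablePred p] (σ₀ : Perm α) :
    (Finset.univ.filter fun σ : Perm α => ∀ i, p i → σ i = σ₀ i).card =
      (Fintype.card α - (Finset.univ.filter p).card)! := by
  rw [← card_perm_fixing p]
  refine Finset.card_equiv (Equiv.mulLeft σ₀⁻¹) fun σ => ?_
  simp [Equiv.symm_apply_eq]

theorem card_perm_apply_eq (i u : α) :
    (Finset.univ.filter fun σ : Perm α => σ i = u).card = (Fintype.card α - 1)! := by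
  have := card_perm_eq_on (· = i) (swap i u)
  simpa [Finset.filter_eq'] using this

theorem card_perm_apply_eq_and {i i' u u' : α} (hi : i ≠ i') (hu : u ≠ u') :
    (Finset.univ.filter fun σ : Perm α => σ i = u ∧ σ i' = u').card =
      (Fintype.card α - 2)! := by
  -- An explicit permutation with `i ↦ u` and `i' ↦ u'`: the second swap corrects the image of `i'`
  -- without disturbing `u`.
  have hc := card_perm_eq_on (fun x => x = i ∨ x = i') (swap (swap i u i') u' * swap i u)
  have h1 : swap (swap i u i') u' (swap i u i) = u := by
    rw [swap_apply_left]
    refine swap_apply_of_ne_of_ne (fun e => hi ?_) hu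
    exact (swap i u).injective ((swap_apply_left i u).trans e)
  have h2 : (Finset.univ.filter fun x : α => x = i ∨ x = i').card = 2 := by
    rw [← Finset.card_pair hi]; congr 1; ext; simp
  rw [h2] at hc
  rw [← hc]
  congr 1
  refine Finset.filter_congr fun σ _ => ?_
  simp only [Perm.mul_apply]
  constructor
  · rintro ⟨rfl, rfl⟩ x (rfl | rfl)
    · exact h1.symm
    · exact (swap_apply_left _ _).symm
  · intro hx
    refine ⟨(hx i (Or.inl rfl)).trans h1, (hx i' (Or.inr rfl)).trans (swap_apply_left _ _)⟩

end PermCounts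

section OrbitCounts

variable {X P : Type*} [Group X] [Fintype X] (f : X →* Perm P) (B : Set P)

open Classical in
/-- Counting the group elements that move `B` onto a block with a given property. -/
theorem card_filter_image (Q : Set P → Prop) :
    (Finset.univ.filter fun x : X => Q (f x '' B)).card =
      {b : Set P | (∃ x, b = f x '' B) ∧ Q b}.ncard *
        (Finset.univ.filter fun x : X => f x '' B = B).card := by
  have himg : {b : Set P | (∃ x, b = f x '' B) ∧ Q b} =
      ((Finset.univ.filter fun x : X => Q (f x '' B)).image fun x => f x '' B : Finset (Set P)) := by
    ext b
    simp only [Set.mem_ofPred_eq, Finset.coe_image, Finset.coe_filter, Finset.mem_univ, true_and,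
      Set.mem_image]
    constructor
    · rintro ⟨⟨x, rfl⟩, hb⟩; exact ⟨x, hb, rfl⟩
    · rintro ⟨x, hb, rfl⟩; exact ⟨⟨x, rfl⟩, hb⟩
  rw [himg, Set.ncard_coe_finset]
  -- The fibre over each block is a left coset of the stabilizer of `B`.
  rw [Finset.card_eq_sum_card_image fun x => f x '' B]
  refine Finset.sum_const_nat fun b hb => ?_
  obtain ⟨x₀, h0, rfl⟩ := Finset.mem_image.1 hb
  refine Finset.card_equiv (Equiv.mulLeft x₀⁻¹) fun x => ?_
  simp only [Finset.mem_filter, Finset.mem_univ, true_and, coe_mulLeft] at h0 ⊢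
  have : f x '' B = f x₀ '' B ↔ f (x₀⁻¹ * x) '' B = B := by
    conv_rhs => rw [← (f x₀).injective.image_injective.eq_iff, ← Set.image_comp, ← Perm.coe_mul,
      ← map_mul, mul_inv_cancel_left]
  rw [← this]
  exact ⟨fun hx => hx.2, fun hx => ⟨hx ▸ h0, hx⟩⟩

open Classical in
/-- If the stabilizer of `s` is transitive on `s`, then its order is the size of `s` times the
order of a point stabilizer in it. -/
theorem card_stabilizer_of_transitive (s : Finset P) {p : P} (hp : p ∈ s)
    (htrans : ∀ q ∈ s, ∃ x, f x '' (s : Set P) = s ∧ f x p = q) :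
    (Finset.univ.filter fun x : X => f x '' (s : Set P) = s).card =
      s.card * (Finset.univ.filter fun x : X => f x '' (s : Set P) = s ∧ f x p = p).card := by
  rw [Finset.card_eq_sum_card_fiberwise (f := fun x => f x p) (t := s)]
  · refine Finset.sum_const_nat fun q hq => ?_
    obtain ⟨x₀, h1, h2⟩ := htrans q hq
    refine Finset.card_equiv (Equiv.mulLeft x₀⁻¹) fun x => ?_
    have h3 : f x '' (s : Set P) = s ↔ f (x₀⁻¹ * x) '' (s : Set P) = s := by
      conv_rhs => rw [← (f x₀).injective.image_injective.eq_iff, ← Set.image_comp, ← Perm.coe_mul,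
        ← map_mul, mul_inv_cancel_left, h1]
    have h4 : f x p = q ↔ f (x₀⁻¹ * x) p = p := by
      rw [map_mul, map_inv, Perm.mul_apply, Perm.inv_eq_iff_eq, h2]
    simp only [Finset.mem_filter, Finset.mem_univ, true_and, coe_mulLeft]
    rw [h3, h4]
  · intro x hx
    have hx' : f x '' (s : Set P) = s := by simpa using hx
    rw [← hx']
    exact ⟨p, hp, rfl⟩

end OrbitCounts

end

/-! ### The two groups, flag-transitivity and the 1-design. -/

section

/-- The product action of `Sym(R) × Sym(C)` on the grid, as a homomorphism. -/
def gridHom (m : ℕ) : Perm (Fin m) × Perm (Fin m) →* Perm (Grid m) where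
  toFun x := Equiv.prodCongr x.1 x.2
  map_one' := rfl
  map_mul' _ _ := rfl

theorem gridHom_apply {m : ℕ} (x : Perm (Fin m) × Perm (Fin m)) (p : Grid m) :
    gridHom m x p = (x.1 p.1, x.2 p.2) := rfl

theorem mem_groupK_iff {m : ℕ} {g : Perm (Grid m)} : g ∈ groupK m ↔ ∃ x, g = gridHom m x :=
  ⟨fun ⟨σ, ρ, hg⟩ => ⟨(σ, ρ), hg⟩, fun ⟨x, hg⟩ => ⟨x.1, x.2, hg⟩⟩

variable {m a : ℕ}

theorem mem_designD_blocks (h : a ≤ m) {b : Set (Grid m)} :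
    b ∈ (designD (evenCycle m (2 * a))).blocks ↔
      ∃ x, b = gridHom m x '' (cycleBlock h : Set (Grid m)) := by
  rw [coe_cycleBlock]
  constructor
  · rintro ⟨g, hg, rfl⟩
    obtain ⟨x, rfl⟩ := mem_groupK_iff.1 hg
    exact ⟨x, rfl⟩
  · rintro ⟨x, rfl⟩
    exact ⟨_, mem_groupK_iff.2 ⟨x, rfl⟩, rfl⟩

theorem tau_mul_self : tau m * tau m = 1 := rfl

theorem tau_conj_mem {g : Perm (Grid m)} (hg : g ∈ groupK m) : tau m * g * tau m ∈ groupK m := by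
  obtain ⟨σ, ρ, rfl⟩ := hg
  exact ⟨ρ, σ, rfl⟩

theorem groupK_le_groupG : groupK m ≤ groupG m :=
  fun _ hg => Subgroup.subset_closure (Or.inl hg)

theorem tau_mem_groupG : tau m ∈ groupG m := Subgroup.subset_closure (Or.inr rfl)

/-- As `τ` is an involution normalizing `K`, the set `K ∪ Kτ` is closed under the group operations.
-/
theorem mem_groupK_or_of_mem_groupG {g : Perm (Grid m)} (hg : g ∈ groupG m) :
    g ∈ groupK m ∨ ∃ g' ∈ groupK m, g = g' * tau m := by
  induction hg using Subgroup.closure_induction with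
  | mem x hx =>
    rcases hx with hx | rfl
    · exact Or.inl hx
    · exact Or.inr ⟨1, one_mem _, (one_mul _).symm⟩
  | one => exact Or.inl (one_mem _)
  | mul x y _ _ hx hy =>
    rcases hx with hx | ⟨x', hx, rfl⟩ <;> rcases hy with hy | ⟨y', hy, rfl⟩
    · exact Or.inl (mul_mem hx hy)
    · exact Or.inr ⟨_, mul_mem hx hy, (mul_assoc _ _ _).symm⟩
    · refine Or.inr ⟨_, mul_mem hx (tau_conj_mem hy), ?_⟩
      simp only [mul_assoc, tau_mul_self, mul_one]
    · refine Or.inl ?_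
      have := mul_mem hx (tau_conj_mem hy)
      simpa only [mul_assoc] using this
  | inv x _ hx =>
    rcases hx with hx | ⟨x', hx, rfl⟩
    · exact Or.inl (inv_mem hx)
    · refine Or.inr ⟨_, tau_conj_mem (inv_mem hx), ?_⟩
      have : (tau m)⁻¹ = tau m := rfl
      rw [mul_inv_rev, this, mul_assoc, tau_mul_self, mul_one]

theorem designD_eq_designDhat (h : a ≤ m) :
    designD (evenCycle m (2 * a)) = designDhat (evenCycle m (2 * a)) := by
  ext b
  constructor
  · rintro ⟨g, hg, rfl⟩
    exact ⟨g, groupK_le_groupG hg, rfl⟩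
  · rintro ⟨g, hg, rfl⟩
    rcases mem_groupK_or_of_mem_groupG hg with hg' | ⟨g', hg', rfl⟩
    · exact ⟨g, hg', rfl⟩
    · refine ⟨g' * (Equiv.prodCongr (shift h) 1 : Perm (Grid m))⁻¹,
        mul_mem hg' (inv_mem ⟨_, _, rfl⟩), ?_⟩
      rw [← coe_cycleBlock h, Perm.coe_mul, Perm.coe_mul, Set.image_comp, Set.image_comp,
        tau_image_cycleBlock]

theorem image_mem_designOf_iff {H : Subgroup (Perm (Grid m))} {Δ : SimpleGraph (Fin m ⊕ Fin m)}
    {g : Perm (Grid m)} (hg : g ∈ H) (b : Set (Grid m)) :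
    g '' b ∈ (designOf H Δ).blocks ↔ b ∈ (designOf H Δ).blocks := by
  constructor
  · rintro ⟨g', hg', hb⟩
    refine ⟨g⁻¹ * g', mul_mem (inv_mem hg) hg', ?_⟩
    rw [Perm.coe_mul, Set.image_comp, ← hb, ← Set.image_comp, ← Perm.coe_mul, inv_mul_cancel]
    exact (Set.image_id b).symm
  · rintro ⟨g', hg', rfl⟩
    exact ⟨g * g', mul_mem hg hg', by rw [Perm.coe_mul, Set.image_comp]⟩

theorem designD_isFlagTransitive (h : a ≤ m) (h0 : 0 < a) :
    (designD (evenCycle m (2 * a))).IsFlagTransitive (groupK m) := by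
  refine ⟨fun g hg b => image_mem_designOf_iff hg b, ?_⟩
  -- Every flag is an image of the base flag (corner, cycle block); two flags are compared through
  -- it.
  have key : ∀ b ∈ (designD (evenCycle m (2 * a))).blocks, ∀ p ∈ b, ∃ g ∈ groupK m,
      g (⟨0, by omega⟩, ⟨0, by omega⟩) = p ∧ g '' (cycleBlock h : Set (Grid m)) = b := by
    intro b hb p hp
    obtain ⟨x, rfl⟩ := (mem_designD_blocks h).1 hb
    obtain ⟨q, hq, rfl⟩ := hp
    obtain ⟨σ, ρ, h1, h2⟩ := exists_stabilizer_apply_eq h (o := ⟨0, by omega⟩) rfl hq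
    refine ⟨gridHom m x * Equiv.prodCongr σ ρ,
      mul_mem (mem_groupK_iff.2 ⟨x, rfl⟩) ⟨σ, ρ, rfl⟩, ?_, ?_⟩
    · rw [Perm.mul_apply, h2]
    · rw [Perm.coe_mul, Set.image_comp, h1]
  intro b hb p hp b' hb' p' hp'
  obtain ⟨g, hg, rfl, rfl⟩ := key b hb p hp
  obtain ⟨g', hg', rfl, rfl⟩ := key b' hb' p' hp'
  refine ⟨g' * g⁻¹, mul_mem hg' (inv_mem hg), ?_, ?_⟩
  · simp
  · rw [← Set.image_comp, ← Perm.coe_mul, inv_mul_cancel_right]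

theorem designD_isFlagTransitive_groupG (h : a ≤ m) (h0 : 0 < a) :
    (designD (evenCycle m (2 * a))).IsFlagTransitive (groupG m) := by
  refine ⟨fun g hg b => ?_, fun b hb p hp b' hb' p' hp' => ?_⟩
  · rw [designD_eq_designDhat h]
    exact image_mem_designOf_iff hg b
  · obtain ⟨g, hg, hgp⟩ := (designD_isFlagTransitive h h0).2 b hb p hp b' hb' p' hp'
    exact ⟨g, groupK_le_groupG hg, hgp⟩

theorem ncard_of_mem_blocks (h : a ≤ m) (ha : 2 ≤ a) {b : Set (Grid m)}
    (hb : b ∈ (designD (evenCycle m (2 * a))).blocks) : b.ncard = 2 * a := by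
  obtain ⟨x, rfl⟩ := (mem_designD_blocks h).1 hb
  rw [Set.ncard_image_of_injective _ (gridHom m x).injective, Set.ncard_coe_finset,
    card_cycleBlock h ha]

/-- The number of blocks containing a set is invariant under automorphisms. -/
theorem ncard_blocks_containing_image {P : Type*} (D : IncidenceStructure P) {g : Perm P}
    (hg : ∀ b : Set P, g '' b ∈ D.blocks ↔ b ∈ D.blocks) (T : Set P) :
    {b ∈ D.blocks | g '' T ⊆ b}.ncard = {b ∈ D.blocks | T ⊆ b}.ncard := by
  rw [← Set.ncard_image_of_injective {b ∈ D.blocks | T ⊆ b} g.injective.image_injective]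
  congr 1
  ext b
  constructor
  · rintro ⟨hb, hT⟩
    have hgb : g '' (g.symm '' b) = b := by rw [← Set.image_comp]; simp
    refine ⟨g.symm '' b, ⟨?_, ?_⟩, hgb⟩
    · rwa [← hg, hgb]
    · rwa [← Set.image_subset_image_iff g.injective, hgb]
  · rintro ⟨b, ⟨hb, hT⟩, rfl⟩
    exact ⟨(hg b).2 hb, Set.image_mono hT⟩

theorem corner_mem_cycleBlock (h : a ≤ m) {o : Fin m} (ho : o.val = 0) (h0 : 0 < a) :
    (o, o) ∈ cycleBlock h := (mem_cycleBlock h).2 ⟨by dsimp only; omega, Or.inl rfl⟩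

theorem designD_isDesign_one (h : a ≤ m) (ha : 2 ≤ a) :
    ∃ lam : ℕ, (designD (evenCycle m (2 * a))).IsDesign 1 (m ^ 2) (2 * a) lam := by
  let o : Fin m := ⟨0, by omega⟩
  refine ⟨{b ∈ (designD (evenCycle m (2 * a))).blocks | {(o, o)} ⊆ b}.ncard, one_pos,
    pow_pos (by omega) 2, by omega, ?_, ?_, fun b hb => ncard_of_mem_blocks h ha hb, ?_⟩
  · rw [Set.ncard_pos]
    refine ⟨cycleBlock h, (mem_designD_blocks h).2 ⟨1, ?_⟩, ?_⟩
    · rw [map_one]; exact (Set.image_id _).symm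
    · rw [Set.singleton_subset_iff]
      exact corner_mem_cycleBlock h rfl (by omega)
  · simp [sq]
  · intro T hT
    obtain ⟨⟨i, j⟩, rfl⟩ := Finset.card_eq_one.1 hT
    have hg : (Equiv.prodCongr (swap o i) (swap o j) : Perm (Grid m)) ∈ groupK m := ⟨_, _, rfl⟩
    rw [← ncard_blocks_containing_image _
      ((designD_isFlagTransitive h (by omega)).1 _ hg) {(o, o)},
      Set.image_singleton]
    simp

/-! ### Blocks through pairs and triples. -/

/-- A row meets the block at most in the columns `u` and `shift⁻¹ u`, since cycle vertices have
degree two. -/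
theorem row_eq_of_mem_cycleBlock (h : a ≤ m) {u v v' v'' : Fin m} (h1 : (u, v) ∈ cycleBlock h)
    (h2 : (u, v') ∈ cycleBlock h) (h3 : (u, v'') ∈ cycleBlock h) (hv : v ≠ v') (hv' : v ≠ v'') :
    v' = v'' := by
  rw [mem_cycleBlock] at h1 h2 h3
  obtain ⟨-, h1⟩ := h1
  obtain ⟨-, h2⟩ := h2
  obtain ⟨-, h3⟩ := h3
  dsimp only at h1 h2 h3
  have hinj := (shift h).injective
  rcases h1 with h1 | h1 <;> rcases h2 with h2 | h2 <;> rcases h3 with h3 | h3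
  · exact h2.symm.trans h3
  · exact absurd (h1.symm.trans h2) hv
  · exact absurd (h1.symm.trans h3) hv'
  · exact hinj (h2.symm.trans h3)
  · exact h2.symm.trans h3
  · exact absurd (hinj (h1.symm.trans h3)) hv'
  · exact absurd (hinj (h1.symm.trans h2)) hv
  · exact hinj (h2.symm.trans h3)

/-- Each cell of the block has exactly one other cell in its row, so a pair is determined by its
first entry. -/
theorem card_sameRow (h : a ≤ m) (ha : 2 ≤ a) :
    ((cycleBlock h).offDiag.filter fun q => q.1.1 = q.2.1).card = 2 * a := by
  rw [← card_cycleBlock h ha]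
  refine Finset.card_bij (fun q _ => q.1) ?_ ?_ ?_
  · intro q hq
    exact (Finset.mem_offDiag.1 (Finset.mem_filter.1 hq).1).1
  · rintro ⟨⟨u, v⟩, ⟨u₁, v₁⟩⟩ hq ⟨⟨u', v'⟩, ⟨u₂, v₂⟩⟩ hq' hqq
    simp only [Finset.mem_filter, Finset.mem_offDiag, Prod.mk.injEq, ne_eq] at hq hq' hqq
    obtain ⟨rfl, rfl⟩ := hqq
    obtain ⟨⟨h1, h2, h3⟩, rfl⟩ := hq
    obtain ⟨⟨-, h5, h6⟩, rfl⟩ := hq'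
    rw [row_eq_of_mem_cycleBlock h h1 h2 h5 (fun e => h3 ⟨rfl, e⟩) (fun e => h6 ⟨rfl, e⟩)]
  · rintro ⟨u, v⟩ hp
    obtain ⟨hv, huv⟩ := (mem_cycleBlock h).1 hp
    dsimp only at hv huv
    obtain rfl | rfl := huv
    · refine ⟨((u, u), (u, (shift h).symm u)), ?_, rfl⟩
      have hu : ((shift h).symm u).val < a := by
        rw [← shift_val_lt_iff h, apply_symm_apply]; exact hv
      simp only [Finset.mem_filter, Finset.mem_offDiag, and_true, ne_eq, Prod.mk.injEq, true_and]
      refine ⟨hp, (mem_cycleBlock h).2 ⟨hu, Or.inr (apply_symm_apply _ _).symm⟩, fun e => ?_⟩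
      exact shift_ne h ha hv ((Equiv.eq_symm_apply _).1 e)
    · refine ⟨((shift h v, v), (shift h v, shift h v)), ?_, rfl⟩
      simp only [Finset.mem_filter, Finset.mem_offDiag, and_true, ne_eq, Prod.mk.injEq, true_and]
      exact ⟨hp, (mem_cycleBlock h).2 ⟨(shift_val_lt_iff h v).2 hv, Or.inl rfl⟩,
        (shift_ne h ha hv).symm⟩

theorem card_sameColumn (h : a ≤ m) (ha : 2 ≤ a) :
    ((cycleBlock h).offDiag.filter fun q => q.1.2 = q.2.2).card = 2 * a := by
  rw [← card_cycleBlock h ha]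
  refine Finset.card_bij (fun q _ => q.1) ?_ ?_ ?_
  · intro q hq
    exact (Finset.mem_offDiag.1 (Finset.mem_filter.1 hq).1).1
  · rintro ⟨⟨u, v⟩, ⟨u₁, v₁⟩⟩ hq ⟨⟨u', v'⟩, ⟨u₂, v₂⟩⟩ hq' hqq
    simp only [Finset.mem_filter, Finset.mem_offDiag, Prod.mk.injEq, ne_eq, mem_cycleBlock]
      at hq hq' hqq ⊢
    grind
  · rintro ⟨u, v⟩ hp
    obtain ⟨hv, huv⟩ := (mem_cycleBlock h).1 hp
    dsimp only at hv huv
    have h1 : (v, v) ∈ cycleBlock h := (mem_cycleBlock h).2 ⟨hv, Or.inl rfl⟩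
    have h2 : (shift h v, v) ∈ cycleBlock h := (mem_cycleBlock h).2 ⟨hv, Or.inr rfl⟩
    have h3 := shift_ne h ha hv
    obtain rfl | rfl := huv
    · exact ⟨((u, u), (shift h u, u)), by simp [h1, h2, h3.symm], rfl⟩
    · exact ⟨((shift h v, v), (v, v)), by simp [h1, h2, h3], rfl⟩

/-- Of the `2a (2a - 1)` ordered pairs, remove the two disjoint families of size `2a`. -/
theorem card_general (h : a ≤ m) (ha : 2 ≤ a) :
    ((cycleBlock h).offDiag.filter fun q => q.1.1 ≠ q.2.1 ∧ q.1.2 ≠ q.2.2).card =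
      2 * a * (2 * a - 3) := by
  have h1 := Finset.card_filter_add_card_filter_not (s := (cycleBlock h).offDiag)
    (fun q => q.1.1 = q.2.1)
  have h2 := Finset.card_filter_add_card_filter_not
    (s := (cycleBlock h).offDiag.filter fun q => ¬ q.1.1 = q.2.1) (fun q => q.1.2 = q.2.2)
  have h3 : ((cycleBlock h).offDiag.filter fun q => ¬ q.1.1 = q.2.1).filter
      (fun q => q.1.2 = q.2.2) = (cycleBlock h).offDiag.filter fun q => q.1.2 = q.2.2 := by
    rw [Finset.filter_filter]
    refine Finset.filter_congr fun q hq => and_iff_right_of_imp fun e e' => ?_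
    exact (Finset.mem_offDiag.1 hq).2.2 (Prod.ext e' e)
  rw [h3, card_sameColumn h ha, Finset.filter_filter] at h2
  rw [card_sameRow h ha, Finset.offDiag_card, card_cycleBlock h ha] at h1
  obtain ⟨c, rfl⟩ := Nat.exists_eq_add_of_le ha
  have h4 : 2 * (2 + c) - 3 = 2 * c + 1 := by omega
  have h5 : 2 * (2 + c) * (2 * (2 + c)) - 2 * (2 + c) = 2 * (2 + c) * (2 * c + 1) +
      4 * (2 + c) := by
    rw [← Nat.mul_sub_one, show 2 * (2 + c) - 1 = 2 * c + 1 + 2 by omega]; ring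
  rw [h4]
  rw [h5] at h1
  simp only [ne_eq]
  omega

open Classical in
theorem card_stabilizer (h : a ≤ m) (ha : 2 ≤ a) :
    (Finset.univ.filter fun x => gridHom m x '' (cycleBlock h : Set (Grid m)) =
      cycleBlock h).card = 2 * a * ((m - a)! ^ 2) := by
  let o : Fin m := ⟨0, by omega⟩
  rw [card_stabilizer_of_transitive (gridHom m) (cycleBlock h)
    (corner_mem_cycleBlock h (o := o) rfl (by omega)), card_cycleBlock h ha]
  · congr 1
    have hfix : (Finset.univ.filter fun σ : Perm (Fin m) => ∀ i : Fin m, i.val < a → σ i = i).card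
        = (m - a)! := by
      have := card_perm_fixing fun i : Fin m => i.val < a
      rw [card_filter_val_lt h, Fintype.card_fin] at this
      convert this
    rw [sq]
    nth_rw 1 [← hfix]
    rw [← hfix, ← Finset.card_product]
    congr 1
    ext ⟨σ, ρ⟩
    simp only [Finset.mem_filter, Finset.mem_univ, true_and, Finset.mem_product]
    exact stabilizer_fixing_corner_iff h ha (o := o) rfl σ ρ
  · intro q hq
    obtain ⟨σ, ρ, h1, h2⟩ := exists_stabilizer_apply_eq h (o := o) rfl hq
    exact ⟨(σ, ρ), h1, h2⟩

open Classical in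
theorem ncard_blocks_containing_pair (h : a ≤ m) (ha : 2 ≤ a) (p q : Grid m) :
    {b ∈ (designD (evenCycle m (2 * a))).blocks | {p, q} ⊆ b}.ncard *
      (2 * a * ((m - a)! ^ 2)) =
    (Finset.univ.filter fun x => gridHom m x p ∈ cycleBlock h ∧
      gridHom m x q ∈ cycleBlock h).card := by
  rw [← card_stabilizer h ha]
  simp only [mem_designD_blocks h]
  rw [← card_filter_image (gridHom m) (cycleBlock h : Set (Grid m)) ({p, q} ⊆ ·)]
  -- Inversion trades moving the block over the pair for moving the pair into the block.
  refine Finset.card_equiv (Equiv.inv _) fun x => ?_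
  simp only [Finset.mem_filter, Finset.mem_univ, true_and, Equiv.inv_apply, map_inv,
    Set.insert_subset_iff, Set.singleton_subset_iff, Set.mem_image_equiv, Finset.mem_coe]
  rfl

/-- Sort group elements by the image of the pair, one of `2a` targets: each target prescribes one
value of the row permutation and two of the column permutation. -/
theorem ncard_blocks_containing_row_pair (h : a ≤ m) (ha : 2 ≤ a) (i : Fin m)
    {j j' : Fin m} (hj : j ≠ j') :
    {b ∈ (designD (evenCycle m (2 * a))).blocks | {(i, j), (i, j')} ⊆ b}.ncard *
      (m - a)! ^ 2 = (m - 1)! * (m - 2)! := by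
  classical
  have key := ncard_blocks_containing_pair h ha (i, j) (i, j')
  rw [Finset.card_eq_sum_card_fiberwise (f := fun x => (gridHom m x (i, j), gridHom m x (i, j')))
    (t := (cycleBlock h).offDiag.filter fun q => q.1.1 = q.2.1),
    Finset.sum_const_nat (m := (m - 1)! * (m - 2)!), card_sameRow h ha] at key
  · refine Nat.eq_of_mul_eq_mul_left (show 0 < 2 * a by omega) ?_
    rw [← key]; ring
  · rintro ⟨⟨u, v⟩, ⟨u', v'⟩⟩ hq
    simp only [Finset.mem_filter, Finset.mem_offDiag, ne_eq, Prod.mk.injEq] at hq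
    obtain ⟨⟨hp, hp', hne⟩, rfl⟩ := hq
    have hv : v ≠ v' := fun e => hne ⟨rfl, e⟩
    have h1 := card_perm_apply_eq i u
    have h2 := card_perm_apply_eq_and hj hv
    rw [Fintype.card_fin] at h1 h2
    rw [← h1, ← h2, ← Finset.card_product]
    congr 1
    ext ⟨σ, ρ⟩
    simp only [Finset.mem_filter, Finset.mem_univ, true_and, Finset.mem_product, gridHom_apply,
      Prod.mk.injEq]
    constructor
    · rintro ⟨-, ⟨h3, h4⟩, -, h5⟩; exact ⟨h3, h4, h5⟩
    · rintro ⟨rfl, rfl, rfl⟩; exact ⟨Finset.mem_filter.2 ⟨Finset.mem_univ _, hp, hp'⟩, ⟨rfl, rfl⟩, rfl, rfl⟩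
  · intro x hx
    simp only [Finset.coe_filter, Finset.mem_univ, true_and, Set.mem_ofPred_eq,
      Finset.mem_offDiag] at hx ⊢
    refine ⟨⟨hx.1, hx.2, fun e => hj ?_⟩, rfl⟩
    exact (Prod.mk.inj ((gridHom m x).injective e)).2

/-- Here each of the `2a (2a - 3)` targets prescribes two values of both permutations. -/
theorem ncard_blocks_containing_general_pair (h : a ≤ m) (ha : 2 ≤ a) {i i' j j' : Fin m}
    (hi : i ≠ i') (hj : j ≠ j') :
    {b ∈ (designD (evenCycle m (2 * a))).blocks | {(i, j), (i', j')} ⊆ b}.ncard *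
      (m - a)! ^ 2 = (2 * a - 3) * ((m - 2)! * (m - 2)!) := by
  classical
  have key := ncard_blocks_containing_pair h ha (i, j) (i', j')
  rw [Finset.card_eq_sum_card_fiberwise (f := fun x => (gridHom m x (i, j), gridHom m x (i', j')))
    (t := (cycleBlock h).offDiag.filter fun q => q.1.1 ≠ q.2.1 ∧ q.1.2 ≠ q.2.2),
    Finset.sum_const_nat (m := (m - 2)! * (m - 2)!), card_general h ha] at key
  · refine Nat.eq_of_mul_eq_mul_left (show 0 < 2 * a by omega) ?_
    rw [← mul_assoc (2 * a) (2 * a - 3), ← key]; ring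
  · rintro ⟨⟨u, v⟩, ⟨u', v'⟩⟩ hq
    simp only [Finset.mem_filter, Finset.mem_offDiag, ne_eq] at hq
    obtain ⟨⟨hp, hp', -⟩, hu, hv⟩ := hq
    have h1 := card_perm_apply_eq_and hi hu
    have h2 := card_perm_apply_eq_and hj hv
    rw [Fintype.card_fin] at h1 h2
    nth_rw 1 [← h1]
    rw [← h2, ← Finset.card_product]
    congr 1
    ext ⟨σ, ρ⟩
    simp only [Finset.mem_filter, Finset.mem_univ, true_and, Finset.mem_product, gridHom_apply,
      Prod.mk.injEq]
    constructor
    · rintro ⟨-, ⟨h3, h4⟩, h5, h6⟩; exact ⟨⟨h3, h5⟩, h4, h6⟩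
    · rintro ⟨⟨rfl, rfl⟩, rfl, rfl⟩; exact ⟨Finset.mem_filter.2 ⟨Finset.mem_univ _, hp, hp'⟩, ⟨rfl, rfl⟩, rfl, rfl⟩
  · intro x hx
    simp only [Finset.coe_filter, Finset.mem_univ, true_and, Set.mem_ofPred_eq,
      Finset.mem_offDiag] at hx ⊢
    refine ⟨⟨hx.1, hx.2, fun e => hj ?_⟩, fun e => hi (x.1.injective e),
      fun e => hj (x.2.injective e)⟩
    exact (Prod.mk.inj ((gridHom m x).injective e)).2

/-- The automorphism `tau` reduces this to the row case. -/
theorem ncard_blocks_containing_column_pair (h : a ≤ m) (ha : 2 ≤ a) {i i' : Fin m} (j : Fin m)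
    (hi : i ≠ i') :
    {b ∈ (designD (evenCycle m (2 * a))).blocks | {(i, j), (i', j)} ⊆ b}.ncard *
      (m - a)! ^ 2 = (m - 1)! * (m - 2)! := by
  rw [← ncard_blocks_containing_row_pair h ha j hi, ← ncard_blocks_containing_image _
    (fun b => (designD_isFlagTransitive_groupG h (by omega)).1 _ tau_mem_groupG b)
    {(i, j), (i', j)}, Set.image_pair]
  rfl

theorem designD_isDesign_two (h : a ≤ m) (ha : 2 ≤ a) (hm : m = 2 * a - 2) :
    ∃ lam : ℕ, lam * (m - a)! ^ 2 = (m - 1)! * (m - 2)! ∧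
      (designD (evenCycle m (2 * a))).IsDesign 2 (m ^ 2) (2 * a) lam := by
  let i₀ : Fin m := ⟨0, by omega⟩
  let i₁ : Fin m := ⟨1, by omega⟩
  have h01 : i₀ ≠ i₁ := by simp [i₀, i₁]
  have hlam := ncard_blocks_containing_row_pair h ha i₀ h01
  refine ⟨_, hlam, two_pos, pow_pos (by omega) 2, by omega, ?_, by simp [sq],
    fun b hb => ncard_of_mem_blocks h ha hb, ?_⟩
  · refine Nat.pos_of_ne_zero fun e => ?_
    rw [e, zero_mul] at hlam
    exact (mul_pos (Nat.factorial_pos _) (Nat.factorial_pos _)).ne hlam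
  · intro T hT
    obtain ⟨⟨i, j⟩, ⟨i', j'⟩, hne, rfl⟩ := Finset.card_eq_two.1 hT
    refine Nat.eq_of_mul_eq_mul_right (pow_pos (Nat.factorial_pos (m - a)) 2) ?_
    rw [hlam, Finset.coe_pair]
    by_cases hi : i = i'
    · subst hi
      exact ncard_blocks_containing_row_pair h ha i fun e => hne (by rw [e])
    · by_cases hj : j = j'
      · subst hj
        exact ncard_blocks_containing_column_pair h ha j hi
      · rw [ncard_blocks_containing_general_pair h ha hi hj, ← mul_assoc]
        -- The only use of `m = 2a - 2` in matching the counts: `2a - 3` is the factor `m - 1` of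
        -- `(m - 1)!`.
        rw [show m - 1 = (m - 2) + 1 by omega, Nat.factorial_succ,
          show 2 * a - 3 = m - 2 + 1 by omega]

theorem eq_of_isTDesign_two (h : a ≤ m) (ha : 2 ≤ a)
    (hD : (designD (evenCycle m (2 * a))).IsTDesign 2) :
    m = 2 * a - 2 := by
  obtain ⟨v, k, lam, hD⟩ := hD
  let i₀ : Fin m := ⟨0, by omega⟩
  let i₁ : Fin m := ⟨1, by omega⟩
  have h01 : i₀ ≠ i₁ := by simp [i₀, i₁]
  have h1 := ncard_blocks_containing_row_pair h ha i₀ h01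
  have h2 := ncard_blocks_containing_general_pair h ha h01 h01
  have h3 := hD.card_blocks_containing {(i₀, i₀), (i₀, i₁)} (Finset.card_pair (by simp [h01]))
  have h4 := hD.card_blocks_containing {(i₀, i₀), (i₁, i₁)} (Finset.card_pair (by simp [h01]))
  rw [Finset.coe_pair] at h3 h4
  rw [h3] at h1
  rw [h4, h1, ← mul_assoc] at h2
  have h5 := Nat.eq_of_mul_eq_mul_right (Nat.factorial_pos _) h2
  rw [show m - 1 = (m - 2) + 1 by omega, Nat.factorial_succ] at h5
  have h6 := Nat.eq_of_mul_eq_mul_right (Nat.factorial_pos _) h5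
  omega

theorem not_isTDesign_three (h : a ≤ m) (hm : 3 ≤ m) :
    ¬ (designD (evenCycle m (2 * a))).IsTDesign 3 := by
  rintro ⟨v, k, lam, hD⟩
  let i₀ : Fin m := ⟨0, by omega⟩
  let i₁ : Fin m := ⟨1, by omega⟩
  let i₂ : Fin m := ⟨2, by omega⟩
  have h01 : i₀ ≠ i₁ := by simp [i₀, i₁]
  have h02 : i₀ ≠ i₂ := by simp [i₀, i₂]
  have h12 : i₁ ≠ i₂ := by simp [i₁, i₂]
  have h1 := hD.card_blocks_containing {(i₀, i₀), (i₀, i₁), (i₀, i₂)}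
    (Finset.card_eq_three.2 ⟨_, _, _, by simp [h01], by simp [h02], by simp [h12], rfl⟩)
  -- A block through these three cells would have three cells in one row, so `lam` would be zero.
  refine hD.lam_pos.ne' (h1.symm.trans ?_)
  convert Set.ncard_empty (Set (Grid m))
  rw [Set.eq_empty_iff_forall_notMem]
  rintro b ⟨hb, hT⟩
  obtain ⟨x, rfl⟩ := (mem_designD_blocks h).1 hb
  have hmem : ∀ i : Fin m, (i₀, i) ∈ ({(i₀, i₀), (i₀, i₁), (i₀, i₂)} : Finset (Grid m)) →
      (x.1.symm i₀, x.2.symm i) ∈ cycleBlock h := by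
    intro i hi
    have := hT hi
    rwa [Set.mem_image_equiv] at this
  exact h12 (x.2.symm.injective (row_eq_of_mem_cycleBlock h (hmem i₀ (by simp))
    (hmem i₁ (by simp)) (hmem i₂ (by simp)) (x.2.symm.injective.ne h01)
    (x.2.symm.injective.ne h02)))

end

end GridDesign

open GridDesign in
theorem lemma4p5 (m k : ℕ) (hk : Even k) (hk4 : 4 ≤ k) (hkm : k / 2 ≤ m) :
    designD (evenCycle m k) = designDhat (evenCycle m k) ∧
    (∃ lam : ℕ, (designD (evenCycle m k)).IsDesign 1 (m ^ 2) k lam) ∧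
    (designD (evenCycle m k)).IsFlagTransitive (groupK m) ∧
    (designD (evenCycle m k)).IsFlagTransitive (groupG m) ∧
    (m ≠ 2 → ¬ (designD (evenCycle m k)).IsTDesign 3) ∧
    ((designD (evenCycle m k)).IsTDesign 2 ↔ m = k - 2) ∧
    (m = k - 2 → ∃ lam : ℕ,
      (lam : ℚ) = ((k - 3)! : ℚ) * ((k - 4)! : ℚ) / ((k / 2 - 2)! : ℚ) ^ 2 ∧
      (designD (evenCycle m k)).IsDesign 2 ((k - 2) ^ 2) k lam) := by
  obtain ⟨a, rfl⟩ := even_iff_exists_two_mul.1 hk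
  have ha : 2 ≤ a := by omega
  rw [Nat.mul_div_cancel_left a two_pos] at hkm ⊢
  refine ⟨designD_eq_designDhat hkm, designD_isDesign_one hkm ha,
    designD_isFlagTransitive hkm (by omega), designD_isFlagTransitive_groupG hkm (by omega),
    fun hm => not_isTDesign_three hkm (by omega),
    ⟨eq_of_isTDesign_two hkm ha, fun hm => ?_⟩, fun hm => ?_⟩
  · obtain ⟨lam, -, hD⟩ := designD_isDesign_two hkm ha hm
    exact ⟨_, _, lam, hD⟩
  · obtain ⟨lam, hlam, hD⟩ := designD_isDesign_two hkm ha hm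
    refine ⟨lam, ?_, hm ▸ hD⟩
    rw [show m - a = a - 2 by omega, show m - 1 = 2 * a - 3 by omega,
      show m - 2 = 2 * a - 4 by omega] at hlam
    rw [eq_div_iff (pow_ne_zero 2 (Nat.cast_ne_zero.2 (Nat.factorial_ne_zero _)))]
    exact_mod_cast hlam
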